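/- Let $d\ge 1$ be an integer and $0<q<\infty$. There is a constant $C=C(q,d)>0$, depending only on $q$ and $d$, with the following property. Let $G$ be a compact abelian group with normalized Haar measure $\mu$ and character group $\Gamma$, and let $\{\gamma_i\}_{i\in I}\subset\Gamma$, with $I$ a linearly ordered index set (for instance $I=\mathbb N$), be $d$-dissociated. This means that no $\gamma_i$ is the trivial character and that, whenever $\chi_1,\dots,\chi_m$ are distinct elements of $\{\gamma_i\}$ and $k_1,\dots,k_m\in\{-d,\dots,d\}$ are integers with $\chi_1^{k_1}\cdots\chi_m^{k_m}\equiv 1$, one has $\chi_1^{k_1}\equiv\dots\equiv\chi_m^{k_m}\equiv 1$. Let $$B_\gamma^d=\{\gamma_{k_1}\cdots\gamma_{k_d} : k_1\le\dots\le k_d\}$$ be the polynomial chaos of degree $d$, regarded as a set of functions on $G$ (products that coincide as functions are listed only once). Then $B_\gamma^d$ is a $q$-lacunary system: for all finitely many pairwise different functions $\varphi_1,\dots,\varphi_n\in B_\gamma^d$ and all $c_1,\dots,c_n\in\mathbb C$, $$\Big\|\sum_{k=1}^n c_k\varphi_k\Big\|_{L_q(G,\mu)}\le C\,\Big(\sum_{k=1}^n|c_k|^2\Big)^{1/2}.$$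 -/

import Mathlib

open MeasureTheory

/-- A set `S` of characters of `G` is `d`-dissociated if no finite subset of it contains the trivial
character, and in every relation between the distinct elements of a finite subset of `S`, with
exponents in `{-d, …, d}`, each single factor is trivial. -/
def IsDissociated {G : Type*} [CommGroup G] [TopologicalSpace G]
    (d : ℕ) (S : Set (PontryaginDual G)) : Prop :=
  ∀ F : Finset (PontryaginDual G), (F : Set (PontryaginDual G)) ⊆ S →
    (1 : PontryaginDual G) ∉ F ∧
    ∀ k : PontryaginDual G → ℤ, (∀ χ ∈ F, -(d : ℤ) ≤ k χ ∧ k χ ≤ (d : ℤ)) →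
      ∏ χ ∈ F, χ ^ k χ = 1 → ∀ χ ∈ F, χ ^ k χ = 1

/-- The polynomial chaos of degree `d` of a system of functions `φ`: the set of all functions
`φ_{k_0} ⋯ φ_{k_{d-1}}` with `k_0 ≤ … ≤ k_{d-1}`. -/
def polynomialChaos {X ι : Type*} [LinearOrder ι] (d : ℕ) (φ : ι → X → ℂ) : Set (X → ℂ) :=
  {f | ∃ k : Fin d → ι, Monotone k ∧ f = fun x => ∏ j, φ (k j) x}

/-- The set `B` of functions satisfies Khinchin's `L_2`–`L_q` inequality with constant `κ`:
`‖∑ c_f f‖_{L_q(μ)} ≤ κ ‖(c_f)‖_{l_2}` for all finite linear combinations of (pairwise different)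
elements of `B`. -/
def IsLacunaryWith {X : Type*} [MeasurableSpace X] (μ : Measure X) (q κ : ℝ)
    (B : Set (X → ℂ)) : Prop :=
  ∀ F : Finset (X → ℂ), (F : Set (X → ℂ)) ⊆ B → ∀ c : (X → ℂ) → ℂ,
    eLpNorm (fun x => ∑ f ∈ F, c f * f x) (ENNReal.ofReal q) μ
      ≤ ENNReal.ofReal (κ * √(∑ f ∈ F, ‖c f‖ ^ 2))

/-!
The proof compares characters with independent random roots of unity, by a convexity argument in
the spirit of Riesz products.

A point `z` of the unit circle is a convex combination of the dilated `N`-th roots of unity `2 * u`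
with the weights `(1 + re (conj u * z)) / N` (`sum_vertexWeight_mul`). Hence the value at `(z i)` of
a polynomial `P` that is affine in each variable is a convex combination of the values
`P (2 * u (v i))`, with product weights, and Jensen's inequality bounds `‖P (z i)‖ ^ n` by the
corresponding combination of the `‖P (2 * u (v i))‖ ^ n`. Substitute `z i = ψ i x` for characters
`ψ i` without nontrivial relations with exponents in `{-1, 0, 1}`, and integrate over `x`: in the
expansion of the product of the weights only the constant term survives
(`integral_prod_vertexWeight`), so the moments of `P (ψ)` are bounded by those of `P (2 * v)` for
independent uniform roots of unity `v i` (`integral_norm_pow_le`). For a moment of even order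
`2 * m < 2 * N` the latter are bounded by orthogonality of monomials and a count of the ways in
which a monomial is a product of `m` monomials of `P` (`sum_norm_pow_le`).

An element of the chaos may contain powers of the given characters. It is a product of nontrivial
factors `χ ^ α χ`, with `1 ≤ α χ ≤ d` (`exists_isReducedMonomial`). When the exponent of each `χ` is
prescribed, all compatible products are square-free monomials in the characters `ψ = χ ^ e χ`, and
relations between these with exponents in `{-1, 0, 1}` are relations between the `χ` with exponents
in `{-d, …, d}`, to which dissociation applies (`eLpNorm_sum_le_of_common_exponents`). The general
sum is an average of such sums over all prescriptions of exponents
(`eLpNorm_sum_le_of_isReducedMonomial`). Finally, norms on a probability space increase with the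
exponent, so even exponents suffice.
-/

/-! ### Moments of polynomials at roots of unity -/

/-- The points `u j` have modulus one, and their uniform distribution has the same mixed moments
`E u ^ a * conj u ^ b` as the uniform distribution on the unit circle, for all `a, b < N`. -/
structure HasCircleMoments {N : ℕ} (u : Fin N → ℂ) : Prop where
  norm_eq_one : ∀ j, ‖u j‖ = 1
  sum_pow_mul_conj_pow : ∀ a < N, ∀ b < N,
    ∑ j, u j ^ a * (starRingEnd ℂ) (u j) ^ b = if a = b then (N : ℂ) else 0

/-- The `N`-th roots of unity have the moments of the circle below order `N`. -/
theorem exists_hasCircleMoments (N : ℕ) (hN : N ≠ 0) :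
    ∃ u : Fin N → ℂ, HasCircleMoments u := by
  have hζ := Complex.isPrimitiveRoot_exp N hN
  set ζ := Complex.exp (2 * Real.pi * Complex.I / N)
  have hζ1 : ‖ζ‖ = 1 := hζ.norm'_eq_one hN
  have hconj : ζ * (starRingEnd ℂ) ζ = 1 := by
    rw [Complex.mul_conj, Complex.normSq_eq_norm_sq, hζ1]; norm_num
  refine ⟨fun j => ζ ^ (j : ℕ), fun j => by simp [hζ1], fun a ha b hb => ?_⟩
  have h1 : ∀ j : Fin N, (ζ ^ (j : ℕ)) ^ a * (starRingEnd ℂ) (ζ ^ (j : ℕ)) ^ b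
      = (ζ ^ a * (starRingEnd ℂ) ζ ^ b) ^ (j : ℕ) := fun j => by
    rw [map_pow, ← pow_mul, ← pow_mul, mul_pow, ← pow_mul, ← pow_mul, mul_comm _ a, mul_comm _ b]
  simp_rw [h1]
  rw [Fin.sum_univ_eq_sum_range (fun j => (ζ ^ a * (starRingEnd ℂ) ζ ^ b) ^ j) N]
  split_ifs with hab
  · subst hab
    simp [← mul_pow, hconj]
  · have hne : ζ ^ a * (starRingEnd ℂ) ζ ^ b ≠ 1 := fun h => by
      apply hab
      apply hζ.pow_inj ha hb
      calc ζ ^ a = ζ ^ a * (ζ * (starRingEnd ℂ) ζ) ^ b := by rw [hconj, one_pow, mul_one]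
        _ = (ζ ^ a * (starRingEnd ℂ) ζ ^ b) * ζ ^ b := by ring
        _ = ζ ^ b := by rw [h, one_mul]
    have hN1 : (ζ ^ a * (starRingEnd ℂ) ζ ^ b) ^ N = 1 := by
      rw [mul_pow, ← pow_mul, ← pow_mul, mul_comm a, mul_comm b, pow_mul, pow_mul, ← map_pow,
        hζ.pow_eq_one]
      simp
    rw [geom_sum_eq hne, hN1, sub_self, zero_div]

/-- Almost-orthogonality: if the functions `E p` are orthogonal or have equal "label" `δ p` and
inner product `M`, and every label is shared by at most `K` indices, then Bessel's inequality holds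
up to the factor `K`. -/
theorem sum_norm_sq_le_of_fiber_card_le {V S D : Type*} [Fintype V] [DecidableEq D]
    (s : Finset S) (a : S → ℂ) (E : S → V → ℂ) (δ : S → D) (M : ℝ) (hM : 0 ≤ M) (K : ℕ)
    (horth : ∀ p ∈ s, ∀ q ∈ s,
      ∑ v, E p v * (starRingEnd ℂ) (E q v) = if δ p = δ q then (M : ℂ) else 0)
    (hfib : ∀ p ∈ s, (s.filter fun q => δ q = δ p).card ≤ K) :
    ∑ v, ‖∑ p ∈ s, a p * E p v‖ ^ 2 ≤ M * K * ∑ p ∈ s, ‖a p‖ ^ 2 := by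
  have hexp : ((∑ v, ‖∑ p ∈ s, a p * E p v‖ ^ 2 : ℝ) : ℂ)
      = ∑ p ∈ s, ∑ q ∈ s, a p * (starRingEnd ℂ) (a q) * if δ p = δ q then (M : ℂ) else 0 := by
    push_cast
    simp_rw [← Complex.mul_conj', map_sum, Finset.sum_mul_sum]
    rw [Finset.sum_comm]
    refine Finset.sum_congr rfl fun p hp => ?_
    rw [Finset.sum_comm]
    refine Finset.sum_congr rfl fun q hq => ?_
    rw [← horth p hp q hq, Finset.mul_sum]
    refine Finset.sum_congr rfl fun v _ => ?_
    rw [map_mul]; ring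
  have hpair : ∑ v, ‖∑ p ∈ s, a p * E p v‖ ^ 2
      ≤ ∑ p ∈ s, ∑ q ∈ s, if δ p = δ q then M * ((‖a p‖ ^ 2 + ‖a q‖ ^ 2) / 2) else 0 := by
    calc ∑ v, ‖∑ p ∈ s, a p * E p v‖ ^ 2
        = ‖((∑ v, ‖∑ p ∈ s, a p * E p v‖ ^ 2 : ℝ) : ℂ)‖ := by
          rw [Complex.norm_of_nonneg (by positivity)]
      _ ≤ _ := by
          rw [hexp]
          refine (norm_sum_le _ _).trans (Finset.sum_le_sum fun p _ => ?_)
          refine (norm_sum_le _ _).trans (Finset.sum_le_sum fun q _ => ?_)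
          split_ifs
          · rw [norm_mul, norm_mul, RCLike.norm_conj, Complex.norm_of_nonneg hM]
            nlinarith [sq_nonneg (‖a p‖ - ‖a q‖)]
          · simp
  refine hpair.trans ?_
  have hone : ∀ p ∈ s, (∑ q ∈ s, if δ p = δ q then M * (‖a p‖ ^ 2 / 2) else 0)
      ≤ M * K * (‖a p‖ ^ 2 / 2) := fun p hp => by
    rw [← Finset.sum_filter, Finset.sum_const, nsmul_eq_mul]
    have : ((s.filter fun q => δ p = δ q).card : ℝ) ≤ K := by
      exact_mod_cast (by simpa only [eq_comm] using hfib p hp)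
    calc _ ≤ (K : ℝ) * (M * (‖a p‖ ^ 2 / 2)) := by gcongr
      _ = _ := by ring
  have hsplit : (∑ p ∈ s, ∑ q ∈ s, if δ p = δ q then M * ((‖a p‖ ^ 2 + ‖a q‖ ^ 2) / 2) else 0)
      = (∑ p ∈ s, ∑ q ∈ s, if δ p = δ q then M * (‖a p‖ ^ 2 / 2) else 0)
        + ∑ p ∈ s, ∑ q ∈ s, if δ p = δ q then M * (‖a p‖ ^ 2 / 2) else 0 := by
    nth_rw 3 [Finset.sum_comm]
    simp_rw [← Finset.sum_add_distrib]
    refine Finset.sum_congr rfl fun p _ => Finset.sum_congr rfl fun q _ => ?_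
    by_cases h : δ p = δ q
    · rw [if_pos h, if_pos h, if_pos h.symm]; ring
    · rw [if_neg h, if_neg h, if_neg (Ne.symm h), add_zero]
  rw [hsplit, ← two_mul]
  calc _ ≤ 2 * ∑ p ∈ s, M * K * (‖a p‖ ^ 2 / 2) := by
        gcongr with p hp; exact hone p hp
    _ = _ := by rw [Finset.mul_sum, Finset.mul_sum]; exact Finset.sum_congr rfl fun p _ => by ring

/-- The even moments of a square-free polynomial of degree at most `d` in independent variables with
circle moments. The `m`-th power of the polynomial is a combination of monomials indexed by
`m`-tuples `p`; the `m` sets `A (p j)` lie in the support of the resulting monomial, which has at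
most `d * m` elements, so that at most `2 ^ (d * m * m)` tuples yield the same monomial. -/
theorem sum_norm_pow_le {ι T : Type*} [Fintype ι] [DecidableEq ι] {N m d : ℕ} (hm : m < N)
    {u : Fin N → ℂ} (hu : HasCircleMoments u)
    (F : Finset T) (A : T → Finset ι) (hA : Set.InjOn A F) (hcard : ∀ t ∈ F, (A t).card ≤ d)
    (c : T → ℂ) :
    ∑ v : ι → Fin N, ‖∑ t ∈ F, c t * ∏ i ∈ A t, u (v i)‖ ^ (2 * m)
      ≤ (N : ℝ) ^ Fintype.card ι * (2 ^ (d * m * m) : ℕ) * (∑ t ∈ F, ‖c t‖ ^ 2) ^ m := by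
  classical
  set s : Finset (Fin m → T) := Fintype.piFinset fun _ => F
  -- `δ p` is the multi-exponent of the monomial that belongs to the tuple `p`
  let δ : (Fin m → T) → ι → ℕ := fun p i => (Finset.univ.filter fun j => i ∈ A (p j)).card
  have hδ : ∀ p i, δ p i < N := fun p i =>
    ((Finset.card_filter_le _ _).trans (by simp)).trans_lt hm
  have hpow : ∀ v : ι → Fin N, (∑ t ∈ F, c t * ∏ i ∈ A t, u (v i)) ^ m
      = ∑ p ∈ s, (∏ j, c (p j)) * ∏ i, u (v i) ^ δ p i := fun v => by
    rw [Finset.sum_pow']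
    refine Finset.sum_congr rfl fun p _ => ?_
    rw [Finset.prod_mul_distrib]
    congr 1
    have : ∀ j, ∏ i ∈ A (p j), u (v i) = ∏ i, if i ∈ A (p j) then u (v i) else 1 := fun j => by
      simp
    simp_rw [this]
    rw [Finset.prod_comm]
    refine Finset.prod_congr rfl fun i _ => ?_
    rw [← Finset.prod_filter, Finset.prod_const]
  have hkey := sum_norm_sq_le_of_fiber_card_le s (fun p => ∏ j, c (p j))
    (fun p (v : ι → Fin N) => ∏ i, u (v i) ^ δ p i) δ ((N : ℝ) ^ Fintype.card ι) (by positivity)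
    (2 ^ (d * m * m)) ?_ ?_
  · simp_rw [pow_mul' _ 2 m, ← norm_pow, hpow]
    simp_rw [norm_pow]
    refine hkey.trans_eq ?_
    rw [Finset.sum_pow']
    simp_rw [norm_prod, Finset.prod_pow]
    rfl
  · intro p _ q _
    simp_rw [map_prod, ← Finset.prod_mul_distrib, map_pow]
    rw [← Fintype.piFinset_univ, ← Finset.prod_univ_sum (fun _ : ι => (Finset.univ : Finset (Fin N)))
      fun i k => u k ^ δ p i * (starRingEnd ℂ) (u k) ^ δ q i]
    simp_rw [fun i => hu.sum_pow_mul_conj_pow _ (hδ p i) _ (hδ q i)]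
    split_ifs with h
    · simp [h]
    · obtain ⟨i, hi⟩ := Function.ne_iff.mp h
      exact Finset.prod_eq_zero (Finset.mem_univ i) (if_neg hi)
  · intro p hp
    have hp' : ∀ j, p j ∈ F := Fintype.mem_piFinset.mp hp
    set D : Finset ι := Finset.univ.biUnion fun j => A (p j)
    have hD : D.card ≤ d * m :=
      (Finset.card_biUnion_le_card_mul _ _ d fun j _ => hcard _ (hp' j)).trans (by simp [mul_comm])
    have hpos : ∀ r i, 0 < δ r i ↔ ∃ j, i ∈ A (r j) := fun r i => by
      simp [δ, Finset.card_pos, Finset.filter_nonempty_iff]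
    calc _ ≤ (Fintype.piFinset fun _ : Fin m => D.powerset).card := by
          refine Finset.card_le_card_of_injOn (fun q j => A (q j)) (fun q hq => ?_) ?_
          · rw [Finset.mem_coe, Finset.mem_filter] at hq
            rw [Finset.mem_coe, Fintype.mem_piFinset]
            intro j
            rw [Finset.mem_powerset]
            intro i hi
            obtain ⟨j', hj'⟩ := (hpos p i).mp (hq.2 ▸ (hpos q i).mpr ⟨j, hi⟩)
            exact Finset.mem_biUnion.mpr ⟨j', Finset.mem_univ _, hj'⟩
          · intro q hq r hr hqr
            rw [Finset.mem_coe, Finset.mem_filter] at hq hr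
            funext j
            exact hA (Fintype.mem_piFinset.mp hq.1 j) (Fintype.mem_piFinset.mp hr.1 j)
              (congrFun hqr j)
      _ = 2 ^ (D.card * m) := by simp [pow_mul]
      _ ≤ 2 ^ (d * m * m) := by gcongr; norm_num

/-! ### Characters -/

theorem integral_character_eq_zero {G : Type*} [CommGroup G] [TopologicalSpace G]
    [IsTopologicalGroup G] [MeasurableSpace G] [BorelSpace G] (μ : Measure G)
    [μ.IsMulLeftInvariant] {χ : PontryaginDual G} (hχ : χ ≠ 1) :
    ∫ x, (χ x : ℂ) ∂μ = 0 := by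
  obtain ⟨y, hy⟩ : ∃ y, χ y ≠ 1 := by
    by_contra! h
    exact hχ (PontryaginDual.ext h)
  have h : ∫ x, (χ x : ℂ) ∂μ = (χ y : ℂ) * ∫ x, (χ x : ℂ) ∂μ := by
    rw [← integral_const_mul, ← integral_mul_left_eq_self (fun x => (χ x : ℂ)) y]
    simp only [map_mul, Circle.coe_mul]
  by_contra h0
  exact hy (Circle.ext (mul_right_cancel₀ h0 (by rw [← h, Circle.coe_one, one_mul])))

theorem continuous_coe_character {G : Type*} [CommGroup G] [TopologicalSpace G]
    (χ : PontryaginDual G) : Continuous fun x => (χ x : ℂ) :=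
  (by exact continuous_subtype_val : Continuous fun w : Circle => (w : ℂ)).comp (map_continuous χ)

theorem integrable_character {G : Type*} [CommGroup G] [TopologicalSpace G]
    [MeasurableSpace G] [BorelSpace G] (μ : Measure G) [IsFiniteMeasure μ]
    (χ : PontryaginDual G) : Integrable (fun x => (χ x : ℂ)) μ :=
  .of_bound (continuous_coe_character χ).measurable.aestronglyMeasurable 1
    (ae_of_all _ fun _ => (Circle.norm_coe _).le)

/-- Evaluation of characters at the point `x`, as a homomorphism on the dual group. -/
noncomputable def PontryaginDual.evalHom {G : Type*} [CommGroup G] [TopologicalSpace G] (x : G) :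
    PontryaginDual G →* Circle where
  toFun χ := χ x
  map_one' := rfl
  map_mul' _ _ := rfl

theorem PontryaginDual.coe_prod_zpow_apply {G ι : Type*} [CommGroup G] [TopologicalSpace G]
    (s : Finset ι) (ψ : ι → PontryaginDual G) (k : ι → ℤ) (x : G) :
    (((∏ i ∈ s, ψ i ^ k i) x : Circle) : ℂ) = ∏ i ∈ s, (ψ i x : ℂ) ^ k i := by
  change ((evalHom x (∏ i ∈ s, ψ i ^ k i) : Circle) : ℂ) = _
  rw [map_prod]
  change Circle.coeHom _ = _
  rw [map_prod]
  refine Finset.prod_congr rfl fun i _ => ?_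
  rw [map_zpow]
  exact Circle.coe_zpow _ _

theorem PontryaginDual.coe_pow_apply {G : Type*} [CommGroup G] [TopologicalSpace G]
    (χ : PontryaginDual G) (n : ℕ) (x : G) : ((χ ^ n) x : ℂ) = (χ x : ℂ) ^ n := by
  change ((evalHom x (χ ^ n) : Circle) : ℂ) = _
  rw [map_pow]
  exact Circle.coe_pow _ _

/-! ### Comparison of characters with independent roots of unity -/

/-- The weight of the vertex `2 * u j` in a representation of a point `z` of the unit circle as a
convex combination of the points `2 * u j`, where `u : Fin N → ℂ` has circle moments and `3 ≤ N`.
It is affine in `re z` and `im z`, so it involves only the frequencies `-1, 0, 1` of `z`; the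
dilation by `2` makes this compatible with positivity. -/
noncomputable def vertexWeight (N : ℕ) (u z : ℂ) : ℝ :=
  (1 + ((starRingEnd ℂ) u * z).re) / N

theorem vertexWeight_nonneg (N : ℕ) {u z : ℂ} (hu : ‖u‖ = 1) (hz : ‖z‖ = 1) :
    0 ≤ vertexWeight N u z := by
  have h := Complex.abs_re_le_norm ((starRingEnd ℂ) u * z)
  rw [norm_mul, RCLike.norm_conj, hu, hz, one_mul] at h
  exact div_nonneg (by linarith [(abs_le.mp h).1]) N.cast_nonneg

theorem coe_vertexWeight (N : ℕ) (u z : ℂ) : (vertexWeight N u z : ℂ)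
    = (1 + ((starRingEnd ℂ) u * z + u * (starRingEnd ℂ) z) / 2) / N := by
  have h := Complex.re_eq_add_conj ((starRingEnd ℂ) u * z)
  rw [map_mul, Complex.conj_conj] at h
  rw [vertexWeight, Complex.ofReal_div, Complex.ofReal_add, h]
  simp

theorem sum_vertexWeight {N : ℕ} (hN : 3 ≤ N) {u : Fin N → ℂ} (hu : HasCircleMoments u)
    (z : ℂ) :
    ∑ j, vertexWeight N (u j) z = 1 := by
  have hN0 : (N : ℂ) ≠ 0 := by norm_cast; omega
  have h10 := hu.sum_pow_mul_conj_pow 1 (by omega) 0 (by omega)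
  have h01 := hu.sum_pow_mul_conj_pow 0 (by omega) 1 (by omega)
  simp only [pow_one, pow_zero, mul_one, one_mul, one_ne_zero, zero_ne_one, if_false] at h10 h01
  rw [← Complex.ofReal_inj]
  push_cast
  simp_rw [coe_vertexWeight]
  rw [← Finset.sum_div, Finset.sum_add_distrib, ← Finset.sum_div, Finset.sum_add_distrib,
    ← Finset.sum_mul, ← Finset.sum_mul, h10, h01]
  simp [hN0]

theorem sum_vertexWeight_mul {N : ℕ} (hN : 3 ≤ N) {u : Fin N → ℂ} (hu : HasCircleMoments u)
    (z : ℂ) :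
    ∑ j, (vertexWeight N (u j) z : ℂ) * (2 * u j) = z := by
  have hN0 : (N : ℂ) ≠ 0 := by norm_cast; omega
  have h10 := hu.sum_pow_mul_conj_pow 1 (by omega) 0 (by omega)
  have h11 := hu.sum_pow_mul_conj_pow 1 (by omega) 1 (by omega)
  have h20 := hu.sum_pow_mul_conj_pow 2 (by omega) 0 (by omega)
  simp only [pow_one, pow_zero, mul_one, one_ne_zero, OfNat.ofNat_ne_zero, if_false, if_true]
    at h10 h11 h20
  have h : ∀ j, (vertexWeight N (u j) z : ℂ) * (2 * u j)
      = (2 * u j + u j * (starRingEnd ℂ) (u j) * z + u j ^ 2 * (starRingEnd ℂ) z) / N := fun j => by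
    rw [coe_vertexWeight]; ring
  simp_rw [h]
  rw [← Finset.sum_div, Finset.sum_add_distrib, Finset.sum_add_distrib, ← Finset.mul_sum,
    ← Finset.sum_mul, ← Finset.sum_mul, h10, h11, h20]
  field_simp
  ring

/-- The value of a square-free polynomial at a point of the torus is the average of its values at
the points `2 * u (v i)` for the product of the vertex weights; Jensen's inequality follows. -/
theorem norm_multiaffine_pow_le {ι T : Type*} [Fintype ι] [DecidableEq ι] {N : ℕ} (hN : 3 ≤ N)
    {u : Fin N → ℂ} (hu : HasCircleMoments u)
    (F : Finset T) (A : T → Finset ι) (c : T → ℂ) (n : ℕ) (z : ι → ℂ) (hz : ∀ i, ‖z i‖ = 1) :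
    ‖∑ t ∈ F, c t * ∏ i ∈ A t, z i‖ ^ n ≤ ∑ v : ι → Fin N,
      (∏ i, vertexWeight N (u (v i)) (z i)) * ‖∑ t ∈ F, c t * ∏ i ∈ A t, (2 * u (v i))‖ ^ n := by
  have hw : ∀ v : ι → Fin N, 0 ≤ ∏ i, vertexWeight N (u (v i)) (z i) := fun v =>
    Finset.prod_nonneg fun i _ => vertexWeight_nonneg N (hu.norm_eq_one _) (hz i)
  have hw1 : ∑ v : ι → Fin N, ∏ i, vertexWeight N (u (v i)) (z i) = 1 := by
    rw [← Fintype.piFinset_univ, ← Finset.prod_univ_sum (fun _ : ι => (Finset.univ : Finset (Fin N)))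
      fun i j => vertexWeight N (u j) (z i)]
    exact Finset.prod_eq_one fun i _ => sum_vertexWeight hN hu _
  have hmono : ∀ B : Finset ι, ∏ i ∈ B, z i = ∑ v : ι → Fin N,
      ((∏ i, vertexWeight N (u (v i)) (z i) : ℝ) : ℂ) * ∏ i ∈ B, (2 * u (v i)) := fun B => by
    have h1 : ∀ v : ι → Fin N, ((∏ i, vertexWeight N (u (v i)) (z i) : ℝ) : ℂ)
        * ∏ i ∈ B, (2 * u (v i)) = ∏ i, (vertexWeight N (u (v i)) (z i) : ℂ)
          * if i ∈ B then 2 * u (v i) else 1 := fun v => by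
      rw [Finset.prod_mul_distrib (s := Finset.univ), Complex.ofReal_prod,
        Finset.prod_ite_mem Finset.univ, Finset.univ_inter]
    simp_rw [h1]
    rw [← Fintype.piFinset_univ, ← Finset.prod_univ_sum (fun _ : ι => (Finset.univ : Finset (Fin N)))
      fun i j => (vertexWeight N (u j) (z i) : ℂ) * if i ∈ B then 2 * u j else 1,
      ← Finset.univ_inter B, ← Finset.prod_ite_mem]
    refine Finset.prod_congr rfl fun i _ => ?_
    rw [Finset.univ_inter]
    split_ifs
    · exact (sum_vertexWeight_mul hN hu _).symm
    · simp only [mul_one]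
      rw [← Complex.ofReal_sum, sum_vertexWeight hN hu, Complex.ofReal_one]
  have hP : ∑ t ∈ F, c t * ∏ i ∈ A t, z i = ∑ v : ι → Fin N,
      ((∏ i, vertexWeight N (u (v i)) (z i) : ℝ) : ℂ) * ∑ t ∈ F, c t * ∏ i ∈ A t, (2 * u (v i)) := by
    simp_rw [hmono, Finset.mul_sum]
    rw [Finset.sum_comm]
    exact Finset.sum_congr rfl fun v _ => Finset.sum_congr rfl fun t _ => by ring
  calc _ ≤ (∑ v : ι → Fin N, (∏ i, vertexWeight N (u (v i)) (z i))
        * ‖∑ t ∈ F, c t * ∏ i ∈ A t, (2 * u (v i))‖) ^ n := by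
        gcongr
        rw [hP]
        refine (norm_sum_le _ _).trans_eq (Finset.sum_congr rfl fun v _ => ?_)
        rw [norm_mul, Complex.norm_of_nonneg (hw v)]
    _ ≤ _ := Real.pow_arith_mean_le_arith_mean_pow _ _ _ (fun v _ => hw v) hw1
        (fun v _ => norm_nonneg _) n

/-- If the characters `ψ i` satisfy no nontrivial relation with exponents in `{-1, 0, 1}`, then the
Riesz product formed by their vertex weights has the same mean as for independent variables. -/
theorem integral_prod_vertexWeight {G ι : Type*} [CommGroup G] [TopologicalSpace G]
    [IsTopologicalGroup G] [MeasurableSpace G] [BorelSpace G] (μ : Measure G)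
    [μ.IsMulLeftInvariant] [IsProbabilityMeasure μ] [Fintype ι] [DecidableEq ι]
    (ψ : ι → PontryaginDual G)
    (hψ : ∀ k : ι → ℤ, (∀ i, k i ∈ Finset.Icc (-1) 1) → ∏ i, ψ i ^ k i = 1 → k = 0)
    (N : ℕ) (u : ι → ℂ) :
    ∫ x, ∏ i, vertexWeight N (u i) (ψ i x) ∂μ = ((N : ℝ) ^ Fintype.card ι)⁻¹ := by
  -- `b w k` is the coefficient of `z ^ k` in `vertexWeight N w z`, for `k ∈ {-1, 0, 1}`
  let b : ℂ → ℤ → ℂ := fun w k =>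
    if k = 0 then (N : ℂ)⁻¹ else if k = 1 then (starRingEnd ℂ) w / 2 / N else w / 2 / N
  have hw : ∀ i x, (vertexWeight N (u i) (ψ i x) : ℂ)
      = ∑ k ∈ Finset.Icc (-1 : ℤ) 1, b (u i) k * (ψ i x : ℂ) ^ k := fun i x => by
    have hI : Finset.Icc (-1 : ℤ) 1 = {-1, 0, 1} := rfl
    rw [coe_vertexWeight, hI]
    simp [b, ← Circle.coe_inv, Circle.coe_inv_eq_conj]
    ring
  have hexp : ∀ x, ((∏ i, vertexWeight N (u i) (ψ i x) : ℝ) : ℂ)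
      = ∑ k ∈ Fintype.piFinset fun _ : ι => Finset.Icc (-1 : ℤ) 1,
        (∏ i, b (u i) (k i)) * ((∏ i, ψ i ^ k i : PontryaginDual G) x : ℂ) := fun x => by
    rw [Complex.ofReal_prod]
    simp_rw [hw]
    rw [Finset.prod_univ_sum]
    refine Finset.sum_congr rfl fun k _ => ?_
    rw [Finset.prod_mul_distrib, PontryaginDual.coe_prod_zpow_apply]
  rw [← Complex.ofReal_inj, ← integral_complex_ofReal]
  simp_rw [hexp]
  rw [integral_finsetSum _ fun k _ => (integrable_character μ _).const_mul _,
    Finset.sum_eq_single (0 : ι → ℤ)]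
  · rw [integral_const_mul]
    simp [b]
  · intro k hk hk0
    rw [integral_const_mul, integral_character_eq_zero μ fun h =>
      hk0 (hψ k (Fintype.mem_piFinset.mp hk) h), mul_zero]
  · intro h
    exact absurd (Fintype.mem_piFinset.mpr fun _ => by simp) h

/-- The even moments of a square-free polynomial in the `ψ i` are dominated by those of the same
polynomial in independent roots of unity dilated by `2`. -/
theorem integral_norm_pow_le {G ι T : Type*} [CommGroup G] [TopologicalSpace G]
    [IsTopologicalGroup G] [MeasurableSpace G] [BorelSpace G] (μ : Measure G)
    [μ.IsMulLeftInvariant] [IsProbabilityMeasure μ] [Fintype ι] [DecidableEq ι]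
    (ψ : ι → PontryaginDual G)
    (hψ : ∀ k : ι → ℤ, (∀ i, k i ∈ Finset.Icc (-1) 1) → ∏ i, ψ i ^ k i = 1 → k = 0)
    (F : Finset T) (A : T → Finset ι) (hA : Set.InjOn A F) {d : ℕ}
    (hcard : ∀ t ∈ F, (A t).card ≤ d) (c : T → ℂ) (m : ℕ) :
    ∫ x, ‖∑ t ∈ F, c t * ∏ i ∈ A t, (ψ i x : ℂ)‖ ^ (2 * m) ∂μ
      ≤ (2 ^ (d * m * m) : ℕ) * (4 ^ d * ∑ t ∈ F, ‖c t‖ ^ 2) ^ m := by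
  -- order `m + 1` is needed for the moment bound, order `3` for the vertex weights
  set N := m + 3
  have hN0 : (0 : ℝ) < N := by positivity
  obtain ⟨u, hu⟩ := exists_hasCircleMoments N (by omega)
  have hcont : ∀ w : ι → ℂ, Continuous fun x => ∏ i, vertexWeight N (w i) (ψ i x) := fun w =>
    continuous_finsetProd _ fun i _ => by
      unfold vertexWeight
      have := continuous_coe_character (ψ i)
      fun_prop
  have hbound : ∀ (w : ι → ℂ), (∀ i, ‖w i‖ = 1) →
      Integrable (fun x => ∏ i, vertexWeight N (w i) (ψ i x)) μ := fun w hw => by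
    refine .of_bound (hcont w).measurable.aestronglyMeasurable 1 (ae_of_all _ fun x => ?_)
    rw [norm_prod]
    refine Finset.prod_le_one (fun _ _ => norm_nonneg _) fun i _ => ?_
    rw [Real.norm_of_nonneg (vertexWeight_nonneg N (hw i) (Circle.norm_coe _)), vertexWeight,
      div_le_one hN0]
    have h := Complex.re_le_norm ((starRingEnd ℂ) (w i) * (ψ i x : ℂ))
    rw [norm_mul, RCLike.norm_conj, hw, Circle.norm_coe, one_mul] at h
    have : (3 : ℝ) ≤ N := by simp [N]
    linarith
  calc _ ≤ ∫ x, ∑ v : ι → Fin N, (∏ i, vertexWeight N (u (v i)) (ψ i x))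
        * ‖∑ t ∈ F, c t * ∏ i ∈ A t, (2 * u (v i))‖ ^ (2 * m) ∂μ := by
        refine integral_mono_of_nonneg (ae_of_all _ fun x => by positivity)
          (integrable_finsetSum _ fun v _ => (hbound _ fun i => hu.norm_eq_one _).mul_const _)
          (ae_of_all _ fun x => ?_)
        exact norm_multiaffine_pow_le (by omega) hu F A c (2 * m) (fun i => (ψ i x : ℂ))
          fun i => Circle.norm_coe _
    _ = ((N : ℝ) ^ Fintype.card ι)⁻¹ * ∑ v : ι → Fin N,
          ‖∑ t ∈ F, (c t * 2 ^ (A t).card) * ∏ i ∈ A t, u (v i)‖ ^ (2 * m) := by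
        rw [integral_finsetSum _ fun v _ => (hbound _ fun i => hu.norm_eq_one _).mul_const _,
          Finset.mul_sum]
        refine Finset.sum_congr rfl fun v _ => ?_
        rw [integral_mul_const, integral_prod_vertexWeight μ ψ hψ]
        simp_rw [Finset.prod_mul_distrib, Finset.prod_const, mul_assoc]
    _ ≤ ((N : ℝ) ^ Fintype.card ι)⁻¹ * ((N : ℝ) ^ Fintype.card ι * (2 ^ (d * m * m) : ℕ)
          * (∑ t ∈ F, ‖c t * 2 ^ (A t).card‖ ^ 2) ^ m) := by
        gcongr
        exact sum_norm_pow_le (by omega) hu F A hA hcard _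
    _ = (2 ^ (d * m * m) : ℕ) * (∑ t ∈ F, ‖c t * 2 ^ (A t).card‖ ^ 2) ^ m := by
        field_simp
    _ ≤ _ := by
        rw [Finset.mul_sum]
        gcongr with t ht
        rw [norm_mul, norm_pow, mul_pow, mul_comm, ← pow_mul, mul_comm (A t).card, pow_mul]
        have : (4 : ℝ) ^ (A t).card ≤ 4 ^ d := pow_le_pow_right₀ (by norm_num) (hcard t ht)
        norm_num
        gcongr

/-! ### Reduced monomials -/

theorem eLpNorm_natCast_le_of_integral_norm_pow_le {X : Type*} [MeasurableSpace X] {μ : Measure X}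
    {p : ℕ} (hp : p ≠ 0) {f : X → ℂ} (hf : MemLp f p μ) {B : ℝ} (hB : 0 ≤ B)
    (h : ∫ x, ‖f x‖ ^ p ∂μ ≤ B ^ p) : eLpNorm f p μ ≤ ENNReal.ofReal B := by
  rw [hf.eLpNorm_eq_integral_rpow_norm (by exact_mod_cast hp) (ENNReal.natCast_ne_top p)]
  simp only [ENNReal.toReal_natCast, Real.rpow_natCast]
  refine ENNReal.ofReal_le_ofReal ?_
  calc _ ≤ (B ^ p) ^ ((p : ℝ)⁻¹) :=
        Real.rpow_le_rpow (integral_nonneg fun x => by positivity) h (by positivity)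
    _ = B := Real.pow_rpow_inv_natCast hB hp

/-- The function `φ` is the product of the `χ ^ α χ` over the support of `α`, which is a set of at
most `d` elements of `S`, with exponents at most `d` and without trivial factors `χ ^ α χ`. The
total degree may be smaller than `d`, since trivial factors are dropped. -/
structure IsReducedMonomial {G : Type*} [CommGroup G] [TopologicalSpace G] (d : ℕ)
    (S : Set (PontryaginDual G)) (α : PontryaginDual G →₀ ℕ) (φ : G → ℂ) : Prop where
  support_subset : (α.support : Set (PontryaginDual G)) ⊆ S
  card_support_le : α.support.card ≤ d
  exponent_le : ∀ χ, α χ ≤ d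
  pow_ne_one : ∀ χ ∈ α.support, χ ^ α χ ≠ 1
  apply_eq : ∀ x, φ x = ∏ χ ∈ α.support, (χ x : ℂ) ^ α χ

theorem IsReducedMonomial.continuous {G : Type*} [CommGroup G] [TopologicalSpace G] {d : ℕ}
    {S : Set (PontryaginDual G)} {α : PontryaginDual G →₀ ℕ} {φ : G → ℂ}
    (h : IsReducedMonomial d S α φ) : Continuous φ := by
  rw [funext h.apply_eq]
  exact continuous_finsetProd _ fun χ _ => (continuous_coe_character χ).pow _

theorem exists_isReducedMonomial {G ι : Type*} [CommGroup G] [TopologicalSpace G] [LinearOrder ι]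
    {d : ℕ} {γ : ι → PontryaginDual G} {φ : G → ℂ}
    (hφ : φ ∈ polynomialChaos d (fun i x => (γ i x : ℂ))) :
    ∃ α, IsReducedMonomial d (Set.range γ) α φ := by
  classical
  obtain ⟨k, -, rfl⟩ := hφ
  let n : PontryaginDual G → ℕ := fun χ => (Finset.univ.filter fun j => γ (k j) = χ).card
  set I : Finset (PontryaginDual G) := Finset.univ.image fun j => γ (k j)
  set I' := I.filter fun χ => χ ^ n χ ≠ 1
  have hn : ∀ χ ∈ I, n χ ≠ 0 := fun χ hχ => by
    obtain ⟨j, -, rfl⟩ := Finset.mem_image.mp hχ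
    exact Finset.card_ne_zero_of_mem (Finset.mem_filter.mpr ⟨Finset.mem_univ j, rfl⟩)
  let α : PontryaginDual G →₀ ℕ := Finsupp.onFinset I' (fun χ => if χ ∈ I' then n χ else 0)
    fun χ h => by by_contra hχ; exact h (if_neg hχ)
  have hα : ∀ χ ∈ I', α χ = n χ := fun χ hχ => if_pos hχ
  have hsupp : α.support = I' := by
    ext χ
    rw [Finsupp.mem_support_iff]
    refine ⟨fun h => ?_, fun h => ?_⟩
    · by_contra hχ; exact h (if_neg hχ)
    · rw [hα χ h]; exact hn χ (Finset.mem_filter.mp h).1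
  refine ⟨α, ?_, ?_, ?_, ?_, ?_⟩
  · rw [hsupp]
    intro χ hχ
    obtain ⟨j, -, rfl⟩ := Finset.mem_image.mp (Finset.mem_filter.mp hχ).1
    exact ⟨_, rfl⟩
  · rw [hsupp]
    exact (Finset.card_filter_le _ _).trans (Finset.card_image_le.trans (by simp))
  · intro χ
    by_cases hχ : χ ∈ I'
    · rw [hα χ hχ]
      exact (Finset.card_filter_le _ _).trans (by simp)
    · exact (if_neg hχ : α χ = 0).trans_le (Nat.zero_le d)
  · rw [hsupp]
    intro χ hχ
    rw [hα χ hχ]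
    exact (Finset.mem_filter.mp hχ).2
  · intro x
    have h1 : ∏ χ ∈ I', (χ x : ℂ) ^ α χ = ∏ χ ∈ I', (χ x : ℂ) ^ n χ :=
      Finset.prod_congr rfl fun χ hχ => by rw [hα χ hχ]
    rw [hsupp, h1, Finset.prod_filter_of_ne]
    · exact Finset.prod_comp (fun χ : PontryaginDual G => (χ x : ℂ)) fun j => γ (k j)
    · intro χ _ h h2
      apply h
      rw [← PontryaginDual.coe_pow_apply, h2]
      rfl

/-! ### Norm bounds for sums of reduced monomials -/

/-- If every `χ` occurs with one and the same exponent `e χ` in all monomials in which it occurs,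
then the monomials are square-free in the characters `χ ^ e χ`. A relation between the latter with
exponents in `{-1, 0, 1}` is one between the `χ` with exponents in `{-d, …, d}`. -/
theorem eLpNorm_sum_le_of_common_exponents {G : Type*} [CommGroup G] [TopologicalSpace G]
    [IsTopologicalGroup G] [MeasurableSpace G] [BorelSpace G] (μ : Measure G)
    [μ.IsMulLeftInvariant] [IsProbabilityMeasure μ] {d : ℕ} {S : Set (PontryaginDual G)}
    (hS : IsDissociated d S) (e : PontryaginDual G → ℕ) (F : Finset (G → ℂ))
    (α : (G → ℂ) → PontryaginDual G →₀ ℕ) (hα : ∀ φ ∈ F, IsReducedMonomial d S (α φ) φ)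
    (he : ∀ φ ∈ F, ∀ χ ∈ (α φ).support, α φ χ = e χ) (c : (G → ℂ) → ℂ) {m : ℕ} (hm : m ≠ 0) :
    eLpNorm (fun x => ∑ φ ∈ F, c φ * φ x) (2 * m : ℕ) μ
      ≤ ENNReal.ofReal (2 ^ (d * m + d) * √(∑ φ ∈ F, ‖c φ‖ ^ 2)) := by
  classical
  set K : Finset (PontryaginDual G) := F.biUnion fun φ => (α φ).support
  have hK : ∀ χ ∈ K, χ ∈ S ∧ e χ ≤ d ∧ χ ^ e χ ≠ 1 := fun χ hχ => by
    obtain ⟨φ, hφ, hχφ⟩ := Finset.mem_biUnion.mp hχ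
    rw [← he φ hφ χ hχφ]
    exact ⟨(hα φ hφ).support_subset hχφ, (hα φ hφ).exponent_le χ, (hα φ hφ).pow_ne_one χ hχφ⟩
  let ψ : K → PontryaginDual G := fun i => (i : PontryaginDual G) ^ e i
  let A : (G → ℂ) → Finset K := fun φ => (α φ).support.subtype (· ∈ K)
  have hsub : ∀ φ ∈ F, ∀ χ ∈ (α φ).support, χ ∈ K := fun φ hφ χ hχ =>
    Finset.mem_biUnion.mpr ⟨φ, hφ, hχ⟩
  have hrep : ∀ φ ∈ F, ∀ x, φ x = ∏ i ∈ A φ, (ψ i x : ℂ) := fun φ hφ x => by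
    have h1 : ∀ i : K, (ψ i x : ℂ) = ((i : PontryaginDual G) x : ℂ) ^ e i :=
      fun i => PontryaginDual.coe_pow_apply _ _ x
    simp_rw [h1]
    rw [Finset.prod_subtype_of_mem (fun χ : PontryaginDual G => (χ x : ℂ) ^ e χ) (hsub φ hφ),
      (hα φ hφ).apply_eq x]
    exact Finset.prod_congr rfl fun χ hχ => by rw [he φ hφ χ hχ]
  have hA : Set.InjOn A F := fun φ hφ φ' hφ' h => funext fun x => by
    rw [hrep φ hφ, hrep φ' hφ', h]
  have hcard : ∀ φ ∈ F, (A φ).card ≤ d := fun φ hφ => by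
    rw [Finset.card_subtype]
    exact (Finset.card_filter_le _ _).trans (hα φ hφ).card_support_le
  have hψ : ∀ k : K → ℤ, (∀ i, k i ∈ Finset.Icc (-1) 1) → ∏ i, ψ i ^ k i = 1 → k = 0 := by
    intro k hk hprod
    let k' : PontryaginDual G → ℤ := fun χ => if h : χ ∈ K then (e χ : ℤ) * k ⟨χ, h⟩ else 0
    have hk' : ∀ i : K, (i : PontryaginDual G) ^ k' i = ψ i ^ k i := fun i => by
      simp only [k', dif_pos i.2, zpow_mul, zpow_natCast]
      rfl
    have hrel := (hS K fun χ hχ => (hK χ hχ).1).2 k' (fun χ hχ => ?_) ?_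
    · funext i
      have hi := hrel i i.2
      rw [hk'] at hi
      have hne : ψ i ≠ 1 := (hK i i.2).2.2
      obtain ⟨h1, h2⟩ := Finset.mem_Icc.mp (hk i)
      obtain h | h | h : k i = -1 ∨ k i = 0 ∨ k i = 1 := by omega
      · rw [h, zpow_neg_one, inv_eq_one] at hi; exact absurd hi hne
      · exact h
      · rw [h, zpow_one] at hi; exact absurd hi hne
    · have h1 : (e χ : ℤ) ≤ d := by exact_mod_cast (hK χ hχ).2.1
      have h0 : (0 : ℤ) ≤ e χ := by positivity
      obtain ⟨h2, h3⟩ := Finset.mem_Icc.mp (hk ⟨χ, hχ⟩)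
      simp only [k', dif_pos hχ]
      constructor <;> nlinarith
    · rw [← Finset.prod_coe_sort, ← hprod]
      exact Finset.prod_congr rfl fun i _ => hk' i
  have hfun : (fun x => ∑ φ ∈ F, c φ * φ x)
      = fun x => ∑ φ ∈ F, c φ * ∏ i ∈ A φ, (ψ i x : ℂ) :=
    funext fun x => Finset.sum_congr rfl fun φ hφ => by rw [← hrep φ hφ x]
  rw [hfun]
  have hcont : Continuous fun x => ∑ φ ∈ F, c φ * ∏ i ∈ A φ, (ψ i x : ℂ) :=
    continuous_finsetSum _ fun φ _ => continuous_const.mul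
      (continuous_finsetProd _ fun i _ => continuous_coe_character (ψ i))
  have hmem : MemLp (fun x => ∑ φ ∈ F, c φ * ∏ i ∈ A φ, (ψ i x : ℂ)) (2 * m : ℕ) μ := by
    refine MemLp.of_bound hcont.measurable.aestronglyMeasurable (∑ φ ∈ F, ‖c φ‖)
      (ae_of_all _ fun x => ?_)
    refine (norm_sum_le _ _).trans (Finset.sum_le_sum fun φ _ => ?_)
    rw [norm_mul, norm_prod, Finset.prod_eq_one fun i _ => Circle.norm_coe (ψ i x), mul_one]
  refine eLpNorm_natCast_le_of_integral_norm_pow_le (by omega) hmem (by positivity) ?_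
  refine (integral_norm_pow_le μ ψ hψ F A hA hcard c m).trans ?_
  have hS0 : 0 ≤ ∑ φ ∈ F, ‖c φ‖ ^ 2 := by positivity
  have hpow : (2 ^ (d * m + d) * √(∑ φ ∈ F, ‖c φ‖ ^ 2)) ^ (2 * m)
      = (2 : ℝ) ^ (d * m * (2 * m)) * (4 ^ d * ∑ φ ∈ F, ‖c φ‖ ^ 2) ^ m := by
    rw [pow_add, mul_assoc, mul_pow, ← pow_mul, pow_mul _ 2 m, mul_pow, Real.sq_sqrt hS0,
      ← pow_mul, mul_comm d 2, pow_mul 2 2 d]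
    norm_num
  rw [hpow]
  push_cast
  gcongr
  · norm_num
  · omega

/-- The exponents of the characters are prescribed at random: over all assignments `e` of exponents
in `{1, …, d}` to the characters, the sum is an average of its parts compatible with `e`, each
monomial being reweighted by the inverse of the probability, at least `d ^ (-d)`, that it is
compatible. -/
theorem eLpNorm_sum_le_of_isReducedMonomial {G : Type*} [CommGroup G] [TopologicalSpace G]
    [IsTopologicalGroup G] [MeasurableSpace G] [BorelSpace G] (μ : Measure G)
    [μ.IsMulLeftInvariant] [IsProbabilityMeasure μ] {d : ℕ} (hd : 1 ≤ d)
    {S : Set (PontryaginDual G)} (hS : IsDissociated d S) (F : Finset (G → ℂ))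
    (hF : ∀ φ ∈ F, ∃ α, IsReducedMonomial d S α φ) (c : (G → ℂ) → ℂ) {m : ℕ} (hm : m ≠ 0) :
    eLpNorm (fun x => ∑ φ ∈ F, c φ * φ x) (2 * m : ℕ) μ
      ≤ ENNReal.ofReal (2 ^ (d * m + d) * d ^ d * √(∑ φ ∈ F, ‖c φ‖ ^ 2)) := by
  classical
  choose! α hα using hF
  have hd0 : (0 : ℝ) < d := by exact_mod_cast hd
  set J : Finset (PontryaginDual G) := F.biUnion fun φ => (α φ).support
  let expo : (J → Fin d) → PontryaginDual G → ℕ := fun e χ =>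
    if h : χ ∈ J then (e ⟨χ, h⟩ : ℕ) + 1 else 0
  -- the monomials that are compatible with the assignment `e`
  let Fc : (J → Fin d) → Finset (G → ℂ) := fun e =>
    F.filter fun φ => ∀ χ ∈ (α φ).support, α φ χ = expo e χ
  -- `∏ i, g φ i (e i)` is `d ^ (α φ).support.card` if `φ` is compatible with `e`, and `0` if not
  let g : (G → ℂ) → J → Fin d → ℝ := fun φ i j =>
    if α φ i = 0 then 1 else if α φ i = (j : ℕ) + 1 then d else 0
  have hg0 : ∀ φ i j, 0 ≤ g φ i j := fun φ i j => by
    dsimp only [g]; split_ifs <;> positivity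
  have hgsum : ∀ φ ∈ F, ∑ e : J → Fin d, ∏ i, g φ i (e i) = (d : ℝ) ^ Fintype.card J := by
    intro φ hφ
    rw [← Fintype.piFinset_univ, ← Finset.prod_univ_sum (fun _ : J => (Finset.univ : Finset (Fin d)))
      (g φ), ← Finset.card_univ, ← Finset.prod_const]
    refine Finset.prod_congr rfl fun i _ => ?_
    by_cases h : α φ i = 0
    · simp [g, h]
    · have hle := (hα φ hφ).exponent_le i
      rw [Finset.sum_eq_single (⟨α φ i - 1, by omega⟩ : Fin d)]
      · simp only [g, if_neg h]
        rw [if_pos (by omega)]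
      · intro j _ hj
        simp only [g, if_neg h]
        rw [if_neg fun hj' => hj (Fin.ext (by simp; omega))]
      · simp
  have hgle : ∀ φ ∈ F, ∀ e : J → Fin d, ∏ i, g φ i (e i) ≤ (d : ℝ) ^ d := by
    intro φ hφ e
    calc ∏ i, g φ i (e i)
        ≤ ∏ i : J, if (i : PontryaginDual G) ∈ (α φ).support then (d : ℝ) else 1 := by
          refine Finset.prod_le_prod (fun i _ => hg0 φ i _) fun i _ => ?_
          by_cases h : α φ i = 0
          · simp [g, h]
          · simp only [g, Finsupp.mem_support_iff, if_neg h, ne_eq]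
            split_ifs
            · exact le_rfl
            · exact hd0.le
      _ = (d : ℝ) ^ (α φ).support.card := by
          rw [Finset.prod_coe_sort J fun χ => if χ ∈ (α φ).support then (d : ℝ) else 1,
            Finset.prod_ite_mem, Finset.prod_const,
            Finset.inter_eq_right.mpr (Finset.subset_biUnion_of_mem (fun φ => (α φ).support) hφ)]
      _ ≤ _ := pow_le_pow_right₀ (by exact_mod_cast hd) (hα φ hφ).card_support_le
  have hgzero : ∀ φ ∈ F, ∀ e : J → Fin d, φ ∉ Fc e → ∏ i, g φ i (e i) = 0 := by
    intro φ hφ e hφe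
    simp only [Fc, Finset.mem_filter, not_and, not_forall] at hφe
    obtain ⟨χ, hχ, hne⟩ := hφe hφ
    have hχJ : χ ∈ J := Finset.mem_biUnion.mpr ⟨φ, hφ, hχ⟩
    refine Finset.prod_eq_zero (Finset.mem_univ ⟨χ, hχJ⟩) ?_
    simp only [expo, dif_pos hχJ] at hne
    simp only [g, if_neg (Finsupp.mem_support_iff.mp hχ), if_neg hne]
  set D : ℝ := (d : ℝ) ^ Fintype.card J
  have hD : 0 < D := by positivity
  let c' : (J → Fin d) → (G → ℂ) → ℂ := fun e φ => ((D⁻¹ * ∏ i, g φ i (e i) : ℝ) : ℂ) * c φ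
  have hdecomp : (fun x => ∑ φ ∈ F, c φ * φ x)
      = ∑ e : J → Fin d, fun x => ∑ φ ∈ Fc e, c' e φ * φ x := by
    funext x
    rw [Finset.sum_apply]
    have h1 : ∀ e : J → Fin d, ∑ φ ∈ Fc e, c' e φ * φ x = ∑ φ ∈ F, c' e φ * φ x := fun e =>
      Finset.sum_subset (Finset.filter_subset _ _) fun φ hφ hφe => by
        simp only [c', hgzero φ hφ e hφe, mul_zero, Complex.ofReal_zero, zero_mul]
    simp_rw [h1]
    rw [Finset.sum_comm]
    refine Finset.sum_congr rfl fun φ hφ => ?_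
    simp only [c']
    rw [← Finset.sum_mul, ← Finset.sum_mul, ← Complex.ofReal_sum, ← Finset.mul_sum, hgsum φ hφ,
      inv_mul_cancel₀ hD.ne', Complex.ofReal_one, one_mul]
  have hmeas : ∀ e ∈ (Finset.univ : Finset (J → Fin d)),
      AEStronglyMeasurable (fun x => ∑ φ ∈ Fc e, c' e φ * φ x) μ := fun e _ => by
    have hcont : Continuous fun x => ∑ φ ∈ Fc e, c' e φ * φ x :=
      continuous_finsetSum _ fun φ hφ =>
        continuous_const.mul (hα φ (Finset.mem_filter.mp hφ).1).continuous
    exact hcont.measurable.aestronglyMeasurable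
  have hpiece : ∀ e : J → Fin d, eLpNorm (fun x => ∑ φ ∈ Fc e, c' e φ * φ x) (2 * m : ℕ) μ
      ≤ ENNReal.ofReal (D⁻¹ * (2 ^ (d * m + d) * d ^ d * √(∑ φ ∈ F, ‖c φ‖ ^ 2))) := fun e => by
    refine (eLpNorm_sum_le_of_common_exponents μ hS (expo e) (Fc e) α
      (fun φ hφ => hα φ (Finset.mem_filter.mp hφ).1) (fun φ hφ => (Finset.mem_filter.mp hφ).2)
      (c' e) hm).trans (ENNReal.ofReal_le_ofReal ?_)
    have hsq : √(∑ φ ∈ Fc e, ‖c' e φ‖ ^ 2) ≤ D⁻¹ * d ^ d * √(∑ φ ∈ F, ‖c φ‖ ^ 2) := by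
      rw [← Real.sqrt_sq (by positivity : 0 ≤ D⁻¹ * (d : ℝ) ^ d), ← Real.sqrt_mul (by positivity),
        Finset.mul_sum]
      refine Real.sqrt_le_sqrt ((Finset.sum_le_sum fun φ hφ => ?_).trans
        (Finset.sum_le_sum_of_subset_of_nonneg (Finset.filter_subset _ F) fun _ _ _ => by positivity))
      have hφF := (Finset.mem_filter.mp hφ).1
      have h0 : 0 ≤ ∏ i, g φ i (e i) := Finset.prod_nonneg fun i _ => hg0 φ i _
      simp only [c']
      rw [norm_mul, mul_pow, Complex.norm_of_nonneg (by positivity)]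
      gcongr
      exact hgle φ hφF e
    calc _ ≤ 2 ^ (d * m + d) * (D⁻¹ * d ^ d * √(∑ φ ∈ F, ‖c φ‖ ^ 2)) := by gcongr
      _ = _ := by ring
  rw [hdecomp]
  refine (eLpNorm_sum_le hmeas (by exact_mod_cast (by omega : 1 ≤ 2 * m))).trans
    ((Finset.sum_le_sum fun e _ => hpiece e).trans_eq ?_)
  rw [Finset.sum_const, ← ENNReal.ofReal_nsmul, nsmul_eq_mul, Finset.card_univ, Fintype.card_fun,
    Fintype.card_fin, Nat.cast_pow, mul_inv_cancel_left₀ hD.ne']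

/-! ### Lacunarity of the polynomial chaos -/

theorem theorem1 (d : ℕ) (hd : 1 ≤ d) (q : ℝ) (hq : 0 < q) :
    ∃ C : ℝ, 0 < C ∧
      ∀ (G : Type*) [CommGroup G] [TopologicalSpace G] [IsTopologicalGroup G] [CompactSpace G]
        [MeasurableSpace G] [BorelSpace G]
        (μ : Measure G) [μ.IsHaarMeasure] [IsProbabilityMeasure μ]
        (ι : Type*) [LinearOrder ι] (γ : ι → PontryaginDual G),
        IsDissociated d (Set.range γ) →
          IsLacunaryWith μ q C (polynomialChaos d (fun i x => (γ i x : ℂ))) := by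
  have hm : ⌈q⌉₊ ≠ 0 := (Nat.ceil_pos.mpr hq).ne'
  -- the constant for the even exponent `2 * ⌈q⌉₊ ≥ q`, which suffices since `μ` has mass one
  refine ⟨2 ^ (d * ⌈q⌉₊ + d) * d ^ d, by positivity, ?_⟩
  intro G _ _ _ _ _ _ μ _ _ ι _ γ hγ F hF c
  have hred : ∀ φ ∈ F, ∃ α, IsReducedMonomial d (Set.range γ) α φ := fun φ hφ =>
    exists_isReducedMonomial (hF hφ)
  have hqm : ENNReal.ofReal q ≤ (2 * ⌈q⌉₊ : ℕ) := by
    refine ENNReal.ofReal_le_of_le_toReal ?_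
    rw [ENNReal.toReal_natCast]
    push_cast
    linarith [Nat.le_ceil q]
  have hcont : Continuous fun x => ∑ φ ∈ F, c φ * φ x :=
    continuous_finsetSum _ fun φ hφ => by
      obtain ⟨α, hα⟩ := hred φ hφ
      exact continuous_const.mul hα.continuous
  exact (eLpNorm_le_eLpNorm_of_exponent_le hqm hcont.measurable.aestronglyMeasurable).trans
    (eLpNorm_sum_le_of_isReducedMonomial μ hd hγ F hred c hm)
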